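/- Let $\log^* x = 1$ for $x \le 1$ and $\log^* x = 1 + \log^*(\log_2 x)$ for $x>1$. Let $G=(V,E)$ be a path or line (a connected acyclic graph of maximum degree at most $2$, finite or infinite) whose nodes carry distinct identifiers $\ell(v)\in\{1,2,\dots\}$. Let $U\subseteq V$ be finite, and let $R\ge 1$ be an integer. A set $S$ is a $U$-limited $(\alpha,\beta)$-ruling set of $G$ if $S\subseteq U$, any two distinct nodes of $S$ are at distance at least $\alpha$ in $G$, and every node of $U$ is at distance at most $\beta$ in $G$ from some node of $S$. For $k\ge 1$, $G^k$ is the graph on $V$ in which two nodes are adjacent if their distance in $G$ lies in $\{1,\dots,k\}$. The algorithm PathRulingSet works as follows. Let $d=\lceil\log_2 R\rceil$ and $S_0=U$. For $i=1,\dots,d$, let $R_i=2^i-1$ if $i\le d-1$ and $R_d=R-1$, and let $S_i$ be the node set of a maximal independent set of the induced subgraph $G^{R_i}[S_{i-1}]$. Put $S_{\mathrm{out}}=S_d$. Then do the following $6$ times: for $v\in U$ let $b_v=\min_{u\in S_{\mathrm{out}}}\operatorname{dist}(v,u)$, let $U_{\mathrm{cand}}=\{v\in U: b_v\ge R\}$,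 and add to $S_{\mathrm{out}}$ all $v\in U_{\mathrm{cand}}$ such that every $u\in U_{\mathrm{cand}}\setminus\{v\}$ with $\operatorname{dist}(u,v)\le R-1$ satisfies $b_u<b_v$, or $b_u=b_v$ and $\ell(u)<\ell(v)$. Return $S_{\mathrm{out}}$. Lemma. (1) For every choice of the maximal independent sets, PathRulingSet returns a $U$-limited $(R,R-1)$-ruling set of $G$. (2) PathRulingSet can be executed in $O(R\log^* n)$ rounds of the deterministic LOCAL model: there are a universal constant $C$ and, for all integers $n\ge 0$ and $R\ge 1$, a deterministic LOCAL algorithm $A_{n,R}$ such that for all $G$, $\ell$ and $U$ as above with $\ell(v)\le n$ for all $v\in U$, if every node $v$ initially knows only $\ell(v)$ and whether $v\in U$, then all nodes of $G$ terminate within $C\,R\log^* n$ rounds of $A_{n,R}$, and the set $S$ of the nodes that output "in the set" is returned by some execution of PathRulingSet (in particular, $S$ is a $U$-limited $(R,R-1)$-ruling set of $G$). -/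

import Mathlib

/-! ### The iterated logarithm -/

/-- `log* x`, normalised so that `log* x = 1` for `x ≤ 1` and `log* x = 1 + log* (log₂ x)` for
`x > 1`: one plus the number of times `log₂` has to be applied to `x` to reach a value `≤ 1`.
The two equations are `logStar_of_le` and `logStar_of_lt` below. -/
noncomputable def logStar (x : ℝ) : ℕ :=
  1 + sInf {k : ℕ | (Real.logb 2)^[k] x ≤ 1}

theorem logStar_of_le {x : ℝ} (hx : x ≤ 1) : logStar x = 1 := by
  simpa [logStar] using Or.inl hx

theorem exists_iterate_logb_le_one (x : ℝ) : ∃ k : ℕ, (Real.logb 2)^[k] x ≤ 1 := by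
  have key : ∀ (m : ℕ) (y : ℝ), y ≤ m + 1 → ∃ k : ℕ, (Real.logb 2)^[k] y ≤ 1 := by
    intro m
    induction m with
    | zero => intro y hy; exact ⟨0, by simpa using hy⟩
    | succ m ih =>
      intro y hy
      by_cases h1 : y ≤ 1
      · exact ⟨0, by simpa using h1⟩
      push Not at h1
      have hlog : Real.logb 2 y ≤ m + 1 := by
        rw [Real.logb_le_iff_le_rpow (by norm_num) (by linarith)]
        have h2 : ((m : ℝ) + 1) + 1 ≤ 2 ^ (m + 1) := by
          exact_mod_cast Nat.succ_le_of_lt (Nat.lt_two_pow_self (n := m + 1))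
        have h3 : (2 : ℝ) ^ ((m : ℝ) + 1) = 2 ^ (m + 1) := by
          exact_mod_cast Real.rpow_natCast 2 (m + 1)
        rw [h3]
        push_cast at hy
        linarith
      obtain ⟨k, hk⟩ := ih _ hlog
      exact ⟨k + 1, by simpa using hk⟩
  obtain ⟨m, hm⟩ := exists_nat_ge x
  exact key m x (by linarith)

theorem logStar_of_lt {x : ℝ} (hx : 1 < x) : logStar x = 1 + logStar (Real.logb 2 x) := by
  have h : sInf {k : ℕ | (Real.logb 2)^[k + 1] x ≤ 1} + 1
      = sInf {k : ℕ | (Real.logb 2)^[k] x ≤ 1} := by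
    refine Nat.sInf_add (p := fun k : ℕ => (Real.logb 2)^[k] x ≤ 1) (n := 1) ?_
    apply Nat.one_le_iff_ne_zero.2
    intro h0
    rcases Nat.sInf_eq_zero.1 h0 with h1 | h1
    · exact absurd h1 (by simpa using hx)
    · obtain ⟨k, hk⟩ := exists_iterate_logb_le_one x
      exact absurd hk (Set.eq_empty_iff_forall_notMem.1 h1 k)
  simp only [Function.iterate_succ_apply] at h
  simp only [logStar]
  omega

/-! ### Graph notions -/

/-- A path or a line: a connected graph without cycles in which all degrees are at most two
(finite paths, the infinite half-line, and the infinite line). -/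
structure IsPathOrLine {V : Type*} (G : SimpleGraph V) : Prop where
  connected : G.Connected
  acyclic : G.IsAcyclic
  degree_le : ∀ v, (G.neighborSet v).encard ≤ 2

/-- The power graph `G ^ k`: distinct nodes are adjacent when their distance is at most `k`. -/
def powerGraph {V : Type*} (G : SimpleGraph V) (k : ℕ) : SimpleGraph V where
  Adj u v := 1 ≤ G.edist u v ∧ G.edist u v ≤ k
  symm := ⟨fun u v h => by rwa [SimpleGraph.edist_comm]⟩
  loopless := ⟨fun v h => by simp at h⟩

/-- Maximal independent sets: independent and dominating. -/
structure IsMIS {W : Type*} (H : SimpleGraph W) (M : Set W) : Prop where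
  independent : ∀ u ∈ M, ∀ v ∈ M, ¬ H.Adj u v
  dominating : ∀ u, u ∉ M → ∃ v ∈ M, H.Adj u v

/-- `S` is a `U`-limited `(α, β)`-ruling set of `G`; all distances are taken in `G`. -/
structure IsLimitedRulingSet {V : Type*} (G : SimpleGraph V) (U : Set V) (α β : ℕ) (S : Set V) :
    Prop where
  subset : S ⊆ U
  packing : ∀ u ∈ S, ∀ v ∈ S, u ≠ v → (α : ℕ∞) ≤ G.edist u v
  covering : ∀ u ∈ U, ∃ v ∈ S, G.edist u v ≤ β

/-! ### The algorithm PathRulingSet -/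

namespace PathRulingSet

/-- `⌈log₂ R⌉`, the number of MIS computations. -/
def depth (R : ℕ) : ℕ := Nat.clog 2 R

/-- The order of the power graph in iteration `i ∈ {1, …, depth R}`. -/
def radius (R i : ℕ) : ℕ := if i < depth R then 2 ^ i - 1 else R - 1

/-- `b_v`, the distance from `v` to the nearest node of `S`. -/
noncomputable def distTo {V : Type*} (G : SimpleGraph V) (S : Set V) (v : V) : ℕ∞ :=
  ⨅ u ∈ S, G.edist v u

/-- The candidates: nodes of `U` at distance at least `R` from `S`. -/
def candidates {V : Type*} (G : SimpleGraph V) (U : Set V) (R : ℕ) (S : Set V) : Set V :=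
  {v | v ∈ U ∧ (R : ℕ∞) ≤ distTo G S v}

/-- One iteration of the greedy extension: every candidate whose pair `(b_v, ℓ v)` is
lexicographically larger than that of all other candidates within distance `R - 1` joins. -/
def greedyStep {V : Type*} (G : SimpleGraph V) (ℓ : V → ℕ+) (U : Set V) (R : ℕ) (S : Set V) :
    Set V :=
  S ∪ {v | v ∈ candidates G U R S ∧
    ∀ u ∈ candidates G U R S, u ≠ v → G.edist v u ≤ ((R - 1 : ℕ) : ℕ∞) →
      distTo G S u < distTo G S v ∨ (distTo G S u = distTo G S v ∧ ℓ u < ℓ v)}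

/-- `Sout` is returned by some execution of PathRulingSet on `(U, R)`. The only freedom in an
execution is which maximal independent set of `G ^ (radius R i) [S_{i-1}]` is computed in each
iteration `i` of the first loop. -/
def IsOutput {V : Type*} (G : SimpleGraph V) (ℓ : V → ℕ+) (U : Set V) (R : ℕ) (Sout : Set V) :
    Prop :=
  ∃ S : ℕ → Set V, S 0 = U ∧
    (∀ i, i < depth R → ∃ M : Set (S i),
      IsMIS ((powerGraph G (radius R (i + 1))).induce (S i)) M ∧
        S (i + 1) = (fun x : S i => (x : V)) '' M) ∧
    Sout = (greedyStep G ℓ U R)^[6] (S (depth R))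

end PathRulingSet

/-! ### Deterministic LOCAL -/

/-- A deterministic algorithm in the LOCAL model, for nodes with initial local input in `In`
and outputs in `Out`. Local computation and message size are unrestricted. In each round a node
broadcasts one message to its neighbours and receives the multiset of the messages of its
neighbours. (Messages are unbounded and may carry identifiers, so this is no loss against
separate messages for separate neighbours, and it is a special case of the latter.) A node has
terminated once `output` is defined on its state. -/
structure LocalAlgorithm (In Out : Type) where
  State : Type
  Msg : Type
  init : In → State
  send : State → Msg
  receive : State → Multiset Msg → State
  output : State → Option Out

namespace LocalAlgorithm

/-- The state of each node after `t` synchronous rounds on the graph `G`. Nodes that have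
terminated keep their state and fall silent. -/
def run {In Out : Type} (A : LocalAlgorithm In Out) {V : Type*} (G : SimpleGraph V)
    [G.LocallyFinite] (input : V → In) : ℕ → V → A.State
  | 0, v => A.init (input v)
  | t + 1, v =>
    if (A.output (run A G input t v)).isSome then run A G input t v
    else A.receive (run A G input t v)
      ((G.neighborFinset v).val.filterMap fun u =>
        if (A.output (run A G input t u)).isSome then none
        else some (A.send (run A G input t u)))

end LocalAlgorithm

open Classical in
/-- The initial local input of a node: its identifier and whether it belongs to `U`. -/
noncomputable def localInput {V : Type*} (ℓ : V → ℕ+) (U : Set V) (v : V) : ℕ+ × Bool :=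
  (ℓ v, decide (v ∈ U))

open Classical in
/-- Within `T` rounds every node terminates, with output `true` exactly at the nodes of `S`. -/
def LocalAlgorithm.ComputesWithin (A : LocalAlgorithm (ℕ+ × Bool) Bool) {V : Type*}
    (G : SimpleGraph V) [G.LocallyFinite] (ℓ : V → ℕ+) (U S : Set V) (T : ℕ) : Prop :=
  ∀ v, A.output (A.run G (localInput ℓ U) T v) = some (decide (v ∈ S))

/-!
Everything takes place in the integers: a path or line embeds isometrically into `ℤ`.

A maximal independent set of `G ^ r [S]` is an `(r + 1)`-packing that covers `S` with radius `r`.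
Since `radius R i < 2 ^ i`, the covering radii of the first loop add up to at most
`2 ^ (depth R + 1) - 2`, so the loop ends with an `R`-packing that covers `U` with radius `4R - 1`.
If some `v` were still a candidate after six greedy iterations, then each iteration would have added
a node of the gap around `v`, namely the candidate `u` with the largest pair `(b_u, ℓ u)` among
those that no node of the current set separates from `v`. Together with `v` these six nodes would
form an `R`-packing inside a gap of the initial set. But each of the seven is at distance at least
`R` and at most `4R - 1` from an end of that gap, so at most three can lie near the same end.

For the running time, `S (i - 1)` is a packing so sparse that `G ^ (radius R i) [S (i - 1)]` has
maximum degree two. Reducing the colours of its nodes in the style of Cole and Vishkin, from the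
identifiers down to a constant number in `log* n - 1` rounds, and then going through the colour
classes yields a maximal independent set. One round on this graph costs `radius R i` rounds on `G`,
and these radii sum to `O(R)`. Hence nodes with equal views of radius `O(R log* n)` make the same
decision, so it can be read off the view, which a node learns in as many rounds.
-/

/-! ### Packings and coverings -/

section PackingCovering

variable {V : Type*} {G : SimpleGraph V} {α β γ : ℕ} {S T U : Set V}

/-- An `α`-packing: distinct nodes of `S` are at distance at least `α`. -/
def IsPacking (G : SimpleGraph V) (α : ℕ) (S : Set V) : Prop :=
  S.Pairwise fun u v => (α : ℕ∞) ≤ G.edist u v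

/-- `S` covers `U` with radius `β`: every node of `U` is within distance `β` of some node of
`S`. -/
def IsCovering (G : SimpleGraph V) (β : ℕ) (U S : Set V) : Prop :=
  ∀ u ∈ U, ∃ v ∈ S, G.edist u v ≤ β

theorem isPacking_one (G : SimpleGraph V) (S : Set V) : IsPacking G 1 S := fun _ _ _ _ huv => by
  simpa using Order.one_le_iff_pos.2 (SimpleGraph.edist_pos_of_ne huv)

theorem IsPacking.mono (hS : IsPacking G α S) (hβ : β ≤ α) : IsPacking G β S :=
  Set.Pairwise.imp hS fun _ _ h => (Nat.cast_le.2 hβ).trans h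

theorem isCovering_refl (G : SimpleGraph V) (U : Set V) : IsCovering G 0 U U :=
  fun u hu => ⟨u, hu, by simp⟩

theorem IsCovering.mono (hS : IsCovering G β U S) (hβ : β ≤ γ) (hST : S ⊆ T) :
    IsCovering G γ U T := fun u hu =>
  let ⟨v, hv, hd⟩ := hS u hu
  ⟨v, hST hv, hd.trans (Nat.cast_le.2 hβ)⟩

theorem IsCovering.trans (hS : IsCovering G β U S) (hT : IsCovering G γ S T) :
    IsCovering G (β + γ) U T := fun u hu =>
  let ⟨v, hv, hd⟩ := hS u hu
  let ⟨w, hw, hd'⟩ := hT v hv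
  ⟨w, hw, by simpa using SimpleGraph.edist_triangle.trans (add_le_add hd hd')⟩

theorem IsMIS.image_isLimitedRulingSet {r : ℕ} {M : Set S}
    (hM : IsMIS ((powerGraph G r).induce S) M) :
    IsLimitedRulingSet G S (r + 1) r ((fun x : S => (x : V)) '' M) where
  subset := by
    rintro _ ⟨x, -, rfl⟩
    exact x.2
  packing := by
    rintro _ ⟨x, hx, rfl⟩ _ ⟨y, hy, rfl⟩ hxy
    have hpos : 1 ≤ G.edist (x : V) y := Order.one_le_iff_pos.2 (SimpleGraph.edist_pos_of_ne hxy)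
    have hfar : (r : ℕ∞) < G.edist (x : V) y :=
      not_le.1 fun hle => hM.independent x hx y hy ⟨hpos, hle⟩
    simpa using Order.add_one_le_of_lt hfar
  covering u hu := by
    by_cases h : (⟨u, hu⟩ : S) ∈ M
    · exact ⟨u, ⟨_, h, rfl⟩, by simp⟩
    · obtain ⟨v, hv, hadj⟩ := hM.dominating _ h
      exact ⟨v, ⟨v, hv, rfl⟩, hadj.2⟩

end PackingCovering

/-! ### Isometric embeddings into the integers -/

/-- `pos` embeds `G` isometrically into the integers. Distances are extended natural numbers, so
such a graph is connected. -/
def IsIntEmbedding {V : Type*} (G : SimpleGraph V) (pos : V → ℤ) : Prop :=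
  ∀ u v, G.edist u v = ((pos u - pos v).natAbs : ℕ∞)

theorem encard_le_of_separated {X : Set ℤ} {p k : ℕ}
    (hsep : X.Pairwise fun x y => p ≤ (x - y).natAbs)
    (hdiam : ∀ x ∈ X, ∀ y ∈ X, (x - y).natAbs < k * p) : X.encard ≤ k := by
  rcases X.eq_empty_or_nonempty with rfl | ⟨x₀, hx₀⟩
  · simp
  have hp : (0 : ℤ) < p := by
    exact_mod_cast Nat.pos_of_mul_pos_left (pos_of_gt (hdiam _ hx₀ _ hx₀))
  obtain ⟨m, hm, hmin⟩ := Int.exists_least_of_bdd (P := (· ∈ X))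
    ⟨x₀ - (k * p : ℕ), fun x hx => by have := hdiam x₀ hx₀ x hx; omega⟩ ⟨x₀, hx₀⟩
  have hmaps : Set.MapsTo (fun x => (x - m) / p) X (Set.Ico (0 : ℤ) k) := fun x hx => by
    have hlt : x - m < (k : ℤ) * p := by
      have := hdiam x hx m hm
      zify at this
      exact (le_abs_self _).trans_lt this
    exact ⟨Int.ediv_nonneg (sub_nonneg.2 (hmin x hx)) hp.le, Int.ediv_lt_of_lt_mul hp hlt⟩
  have hinj : Set.InjOn (fun x => (x - m) / p) X := fun x hx y hy hxy => by
    by_contra hne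
    have hfar := hsep hx hy hne
    have hx' := Int.mul_ediv_add_emod (x - m) p
    have hy' := Int.mul_ediv_add_emod (y - m) p
    have hxy' : (x - m) / p = (y - m) / p := hxy
    rw [hxy'] at hx'
    have := Int.emod_nonneg (x - m) hp.ne'
    have := Int.emod_nonneg (y - m) hp.ne'
    have := Int.emod_lt_of_pos (x - m) hp
    have := Int.emod_lt_of_pos (y - m) hp
    omega
  calc X.encard ≤ (Set.Ico (0 : ℤ) k).encard := Set.encard_le_encard_of_injOn hmaps hinj
    _ = k := by simp [← Finset.coe_Ico, Set.encard_coe_eq_coe_finsetCard]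

namespace IsIntEmbedding

variable {V : Type*} {G : SimpleGraph V} {pos : V → ℤ} {X : Set V} {p k : ℕ}

theorem le_edist_iff (hpos : IsIntEmbedding G pos) {u v : V} {d : ℕ} :
    (d : ℕ∞) ≤ G.edist u v ↔ d ≤ (pos u - pos v).natAbs := by
  rw [hpos, Nat.cast_le]

theorem edist_le_iff (hpos : IsIntEmbedding G pos) {u v : V} {d : ℕ} :
    G.edist u v ≤ d ↔ (pos u - pos v).natAbs ≤ d := by
  rw [hpos, Nat.cast_le]

theorem edist_lt_iff (hpos : IsIntEmbedding G pos) {u v : V} {d : ℕ} :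
    G.edist u v < d ↔ (pos u - pos v).natAbs < d := by
  rw [hpos, Nat.cast_lt]

theorem injective (hpos : IsIntEmbedding G pos) : Function.Injective pos := fun u v huv => by
  simpa [huv] using hpos u v

theorem encard_le (hpos : IsIntEmbedding G pos) (hX : IsPacking G p X)
    (hdiam : ∀ x ∈ X, ∀ y ∈ X, G.edist x y < (k * p : ℕ)) : X.encard ≤ k := by
  rw [← hpos.injective.encard_image]
  refine encard_le_of_separated (p := p) ?_ ?_
  · rintro _ ⟨x, hx, rfl⟩ _ ⟨y, hy, rfl⟩ hne
    exact hpos.le_edist_iff.1 (hX hx hy (ne_of_apply_ne pos hne))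
  · rintro _ ⟨x, hx, rfl⟩ _ ⟨y, hy, rfl⟩
    exact hpos.edist_lt_iff.1 (hdiam x hx y hy)

theorem encard_le_two_mul (hpos : IsIntEmbedding G pos) (P : V → Prop) (hX : IsPacking G p X)
    (hdiam : ∀ x ∈ X, ∀ y ∈ X, (P x ↔ P y) → G.edist x y < (k * p : ℕ)) :
    X.encard ≤ 2 * k := by
  have hP : (X ∩ {x | P x}).encard ≤ k :=
    hpos.encard_le (Set.Pairwise.mono Set.inter_subset_left hX)
      fun x hx y hy => hdiam x hx.1 y hy.1 (iff_of_true hx.2 hy.2)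
  have hnP : (X \ {x | P x}).encard ≤ k :=
    hpos.encard_le (Set.Pairwise.mono Set.sdiff_subset hX)
      fun x hx y hy => hdiam x hx.1 y hy.1 (iff_of_false hx.2 hy.2)
  calc X.encard = (X ∩ {x | P x} ∪ X \ {x | P x}).encard := by rw [Set.inter_union_sdiff]
    _ ≤ (X ∩ {x | P x}).encard + (X \ {x | P x}).encard := Set.encard_union_le _ _
    _ ≤ 2 * k := (add_le_add hP hnP).trans_eq (two_mul _).symm

end IsIntEmbedding

section LocallyInjective

variable {V : Type*} {G : SimpleGraph V} {f : V → ℤ}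

theorem sub_eq_mul_length_of_isPath (hadj : ∀ ⦃u v⦄, G.Adj u v → (f u - f v).natAbs = 1)
    (hinj : ∀ v, Set.InjOn f (G.neighborSet v)) {u w v : V} (huw : G.Adj u w) (q : G.Walk w v)
    (hq : (q.cons huw).IsPath) : f v - f u = (f w - f u) * (q.length + 1) := by
  induction q generalizing u with
  | nil => simp
  | @cons w x v hwx q ih =>
    have hux : u ≠ x := by
      rintro rfl
      simp at hq
    have hne : f u ≠ f x := fun h => hux (hinj w huw.symm hwx h)
    have hstep : f x - f w = f w - f u := by
      have := hadj huw
      have := hadj hwx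
      omega
    have htail := ih hwx hq.of_cons
    rw [hstep] at htail
    rw [SimpleGraph.Walk.length_cons]
    push_cast
    linear_combination htail

theorem isIntEmbedding_of_locally_injective (hG : G.Connected)
    (hadj : ∀ ⦃u v⦄, G.Adj u v → (f u - f v).natAbs = 1)
    (hinj : ∀ v, Set.InjOn f (G.neighborSet v)) : IsIntEmbedding G f := by
  intro u v
  obtain ⟨p, hp⟩ := hG.exists_walk_length_eq_dist u v
  rw [← (hG u v).coe_dist_eq_edist, ← hp]
  cases p with
  | nil => simp
  | cons huw q =>
    have hpath := SimpleGraph.Walk.isPath_of_length_eq_dist _ hp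
    rw [← neg_sub, Int.natAbs_neg, sub_eq_mul_length_of_isPath hadj hinj huw q hpath,
      Int.natAbs_mul, hadj huw.symm, one_mul, SimpleGraph.Walk.length_cons]
    rfl

end LocallyInjective

/-! ### Paths and lines -/

section Tree

variable {V : Type*} {G : SimpleGraph V}

theorem exists_adj_dist_eq_dist_add_one (hG : G.Connected) {r v : V} (h : v ≠ r) :
    ∃ u, G.Adj u v ∧ G.dist r v = G.dist r u + 1 := by
  obtain ⟨p, hp⟩ := hG.exists_walk_length_eq_dist v r
  cases p with
  | nil => exact absurd rfl h
  | @cons _ u _ hvu q =>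
    refine ⟨u, hvu.symm, ?_⟩
    have hq : G.dist u r ≤ q.length := SimpleGraph.dist_le q
    have htri : G.dist v r ≤ G.dist v u + G.dist u r := hG.dist_triangle
    rw [SimpleGraph.dist_eq_one_iff_adj.2 hvu] at htri
    rw [SimpleGraph.Walk.length_cons] at hp
    rw [SimpleGraph.dist_comm (u := r), SimpleGraph.dist_comm (u := r)]
    omega

theorem eq_of_adj_of_dist_eq_dist_add_one (hG : G.IsTree) {r u w v : V} (hu : G.Adj u v)
    (hw : G.Adj w v) (hdu : G.dist r v = G.dist r u + 1) (hdw : G.dist r v = G.dist r w + 1) :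
    u = w := by
  obtain ⟨p, hp⟩ := hG.connected.exists_walk_length_eq_dist r u
  obtain ⟨q, hq⟩ := hG.connected.exists_walk_length_eq_dist r w
  have hp' : (p.concat hu).IsPath := SimpleGraph.Walk.isPath_of_length_eq_dist _ (by
    rw [SimpleGraph.Walk.length_concat]; omega)
  have hq' : (q.concat hw).IsPath := SimpleGraph.Walk.isPath_of_length_eq_dist _ (by
    rw [SimpleGraph.Walk.length_concat]; omega)
  have hpq := congrArg Subtype.val
    ((hG.isAcyclic.subsingleton_path r v).elim ⟨_, hp'⟩ ⟨_, hq'⟩)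
  simpa using congrArg SimpleGraph.Walk.penultimate hpq

open Classical in
/-- The distance of `v` from `r`, with a positive sign exactly when `v` is closer to `a` than
to `r`. For an edge `ra` of a path or line this is the coordinate of `v` with origin `r` and
direction `a`. -/
noncomputable def edgeCoord (G : SimpleGraph V) (r a v : V) : ℤ :=
  if G.dist a v < G.dist r v then G.dist r v else -G.dist r v

theorem natAbs_edgeCoord (r a v : V) : (edgeCoord G r a v).natAbs = G.dist r v := by
  unfold edgeCoord
  split_ifs <;> simp

theorem edgeCoord_pos_iff {r a v : V} : 0 < edgeCoord G r a v ↔ G.dist a v < G.dist r v := by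
  unfold edgeCoord
  split_ifs <;> omega

theorem edgeCoord_pos_iff_of_adj (hG : G.IsTree) {r a u v : V} (ha : G.Adj r a) (hu : u ≠ r)
    (huv : G.Adj u v) (hd : G.dist r v = G.dist r u + 1) :
    0 < edgeCoord G r a u ↔ 0 < edgeCoord G r a v := by
  rw [edgeCoord_pos_iff, edgeCoord_pos_iff]
  have hroot : ∀ x, G.dist r x ≤ G.dist a x + 1 := fun x => by
    have := hG.connected.dist_triangle (u := r) (v := a) (w := x)
    rw [SimpleGraph.dist_eq_one_iff_adj.2 ha] at this
    omega
  have hstep : ∀ {b x y}, G.Adj x y → G.dist b y ≤ G.dist b x + 1 := fun {b x y} hxy => by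
    have := hG.connected.dist_triangle (u := b) (v := x) (w := y)
    rwa [SimpleGraph.dist_eq_one_iff_adj.2 hxy] at this
  refine ⟨fun h => (hstep huv).trans_lt (by omega), fun h => ?_⟩
  have hva : v ≠ a := by
    rintro rfl
    rw [SimpleGraph.dist_eq_one_iff_adj.2 ha] at hd
    exact hu (hG.connected.dist_eq_zero_iff.1 (by omega)).symm
  obtain ⟨w, hw, hwd⟩ := exists_adj_dist_eq_dist_add_one hG.connected hva
  have huw : u = w := by
    have := hroot w
    have := hroot v
    have := hstep (b := r) hw
    exact eq_of_adj_of_dist_eq_dist_add_one hG huv hw hd (by omega)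
  subst huw
  omega

theorem natAbs_edgeCoord_sub_of_adj (hG : G.IsTree) {r a u v : V} (ha : G.Adj r a)
    (huv : G.Adj u v) : (edgeCoord G r a u - edgeCoord G r a v).natAbs = 1 := by
  wlog hd : G.dist r v = G.dist r u + 1 generalizing u v
  · have := this huv.symm ((hG.dist_eq_dist_add_one_of_adj r huv).resolve_right hd)
    omega
  have hu := natAbs_edgeCoord (G := G) r a u
  have hv := natAbs_edgeCoord (G := G) r a v
  by_cases hur : u = r
  · subst hur
    rw [SimpleGraph.dist_self] at hu hd
    omega
  · have := edgeCoord_pos_iff_of_adj hG ha hur huv hd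
    have := hG.connected.pos_dist_of_ne (Ne.symm hur)
    omega

end Tree

namespace IsPathOrLine

variable {V : Type*} {G : SimpleGraph V}

theorem isTree (hG : IsPathOrLine G) : G.IsTree := ⟨hG.connected, hG.acyclic⟩

theorem eq_of_adj_of_adj (hG : IsPathOrLine G) {v a b c : V} (ha : G.Adj v a) (hb : G.Adj v b)
    (hc : G.Adj v c) (hab : a ≠ b) (hac : a ≠ c) : b = c := by
  by_contra hbc
  have hsub : ({a, b, c} : Set V) ⊆ G.neighborSet v := by
    rintro x (rfl | rfl | rfl) <;> assumption
  have hthree : ({a, b, c} : Set V).encard = 3 :=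
    Set.encard_eq_three.2 ⟨a, b, c, hab, hac, hbc, rfl⟩
  have hle := (Set.encard_le_encard hsub).trans (hG.degree_le v)
  rw [hthree] at hle
  exact absurd hle (by decide)

theorem injOn_edgeCoord_neighborSet (hG : IsPathOrLine G) {r a : V} (ha : G.Adj r a) (v : V) :
    Set.InjOn (edgeCoord G r a) (G.neighborSet v) := by
  intro u hu w hw huw
  have hdist : G.dist r u = G.dist r w := by
    rw [← natAbs_edgeCoord r a u, huw, natAbs_edgeCoord]
  rcases hG.isTree.dist_eq_dist_add_one_of_adj r hu with hparent | hchild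
  · exact eq_of_adj_of_dist_eq_dist_add_one hG.isTree hu.symm hw.symm hparent (by omega)
  by_cases hvr : v = r
  · subst hvr
    have hside : ∀ x, G.Adj v x → (0 < edgeCoord G v a x ↔ a = x) := fun x hx => by
      rw [edgeCoord_pos_iff, SimpleGraph.dist_eq_one_iff_adj.2 hx, Nat.lt_one_iff,
        hG.connected.dist_eq_zero_iff]
    have hiff : a = u ↔ a = w := by rw [← hside u hu, huw, hside w hw]
    by_cases hau : a = u
    · exact hau.symm.trans (hiff.1 hau)
    · exact hG.eq_of_adj_of_adj ha hu hw hau (mt hiff.2 hau)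
  · obtain ⟨p, hp, hdp⟩ := exists_adj_dist_eq_dist_add_one hG.connected hvr
    refine hG.eq_of_adj_of_adj hp.symm hu hw ?_ ?_ <;> rintro rfl <;> omega

theorem exists_isIntEmbedding (hG : IsPathOrLine G) : ∃ pos : V → ℤ, IsIntEmbedding G pos := by
  obtain ⟨r⟩ := hG.connected.nonempty
  by_cases h : ∃ a, G.Adj r a
  · obtain ⟨a, ha⟩ := h
    exact ⟨edgeCoord G r a, isIntEmbedding_of_locally_injective hG.connected
      (fun _ _ => natAbs_edgeCoord_sub_of_adj hG.isTree ha) (hG.injOn_edgeCoord_neighborSet ha)⟩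
  · have hr : ∀ v, v = r := fun v => by
      obtain ⟨p⟩ := hG.connected r v
      cases p with
      | nil => rfl
      | cons hadj _ => exact absurd ⟨_, hadj⟩ h
    exact ⟨fun _ => 0, fun u v => by simp [hr u, hr v]⟩

end IsPathOrLine

/-! ### The chain of maximal independent sets -/

namespace PathRulingSet

variable {V : Type*} {G : SimpleGraph V} {ℓ : V → ℕ+} {U : Set V} {R k : ℕ}

theorem radius_zero : radius R 0 = 0 := by
  unfold radius
  split_ifs with h
  · rfl
  · have : R ≤ 2 ^ depth R := Nat.le_pow_clog (by norm_num) R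
    rw [Nat.eq_zero_of_not_pos h] at this
    omega

theorem radius_depth : radius R (depth R) = R - 1 := if_neg (lt_irrefl _)

theorem radius_lt_two_pow {i : ℕ} (hi : i ≤ depth R) : radius R i < 2 ^ i := by
  have hpos := Nat.two_pow_pos i
  unfold radius
  split_ifs with h
  · omega
  · have hR : R ≤ 2 ^ depth R := Nat.le_pow_clog (by norm_num) R
    rw [le_antisymm (not_lt.1 h) hi] at hR
    omega

theorem radius_succ_lt {i : ℕ} (hi : i < depth R) :
    radius R (i + 1) < 2 * (radius R i + 1) := by
  have hrad : radius R i + 1 = 2 ^ i := by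
    rw [radius, if_pos hi, Nat.sub_add_cancel Nat.one_le_two_pow]
  rw [hrad, ← pow_succ']
  exact radius_lt_two_pow hi

theorem two_pow_depth_lt (hR : 1 ≤ R) : 2 ^ depth R < 2 * R := by
  rcases hR.eq_or_lt with rfl | hR
  · simp [depth]
  · have hlt : 2 ^ (depth R).pred < R := Nat.pow_pred_clog_lt_self (by norm_num) hR
    have hdepth : depth R = (depth R).pred + 1 :=
      (Nat.succ_pred_eq_of_pos (Nat.clog_pos (by norm_num) hR)).symm
    rw [hdepth, pow_succ']
    omega

/-- The first `k` iterations of the first loop of PathRulingSet may produce the sets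
`S 1, …, S k` from `S 0 = U`. -/
def IsMISChain (G : SimpleGraph V) (U : Set V) (R : ℕ) (S : ℕ → Set V) (k : ℕ) : Prop :=
  S 0 = U ∧ ∀ i < k, ∃ M : Set (S i),
    IsMIS ((powerGraph G (radius R (i + 1))).induce (S i)) M ∧
      S (i + 1) = (fun x : S i => (x : V)) '' M

theorem isOutput_iff {T : Set V} :
    IsOutput G ℓ U R T ↔ ∃ S : ℕ → Set V, IsMISChain G U R S (depth R) ∧
      T = (greedyStep G ℓ U R)^[6] (S (depth R)) := by
  simp only [IsOutput, IsMISChain, and_assoc]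

namespace IsMISChain

variable {S : ℕ → Set V}

theorem mono (h : IsMISChain G U R S k) {j : ℕ} (hj : j ≤ k) : IsMISChain G U R S j :=
  ⟨h.1, fun i hi => h.2 i (hi.trans_le hj)⟩

theorem isLimitedRulingSet (h : IsMISChain G U R S k) {i : ℕ} (hi : i < k) :
    IsLimitedRulingSet G (S i) (radius R (i + 1) + 1) (radius R (i + 1)) (S (i + 1)) := by
  obtain ⟨M, hM, hS⟩ := h.2 i hi
  exact hS ▸ hM.image_isLimitedRulingSet

theorem subset (h : IsMISChain G U R S k) : S k ⊆ U := by
  induction k with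
  | zero => exact h.1.subset
  | succ k ih => exact (h.isLimitedRulingSet k.lt_succ_self).subset.trans (ih (h.mono k.le_succ))

theorem isPacking (h : IsMISChain G U R S k) : IsPacking G (radius R k + 1) (S k) := by
  cases k with
  | zero => simpa [radius_zero] using isPacking_one G (S 0)
  | succ k => exact fun u hu v hv => (h.isLimitedRulingSet k.lt_succ_self).packing u hu v hv

theorem isCovering_two_pow (h : IsMISChain G U R S k) (hk : k ≤ depth R) :
    IsCovering G (2 ^ (k + 1) - 2) U (S k) := by
  induction k with
  | zero => simpa [h.1] using isCovering_refl G U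
  | succ k ih =>
    refine ((ih (h.mono k.le_succ) (by omega)).trans
      (h.isLimitedRulingSet k.lt_succ_self).covering).mono ?_ subset_rfl
    have hrad := radius_lt_two_pow hk
    have hpos := Nat.two_pow_pos k
    omega

theorem isPacking_depth (h : IsMISChain G U R S (depth R)) : IsPacking G R (S (depth R)) :=
  h.isPacking.mono (by rw [radius_depth]; omega)

theorem isCovering_depth (h : IsMISChain G U R S (depth R)) (hR : 1 ≤ R) :
    IsCovering G (4 * R - 1) U (S (depth R)) := by
  refine (h.isCovering_two_pow le_rfl).mono ?_ subset_rfl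
  have := two_pow_depth_lt hR
  rw [pow_succ']
  omega

end IsMISChain

/-! ### The greedy extension -/

section Greedy

variable {S T X : Set V} {pos : V → ℤ} {v : V}

theorem mem_candidates :
    v ∈ candidates G U R S ↔ v ∈ U ∧ ∀ u ∈ S, (R : ℕ∞) ≤ G.edist v u := by
  simp [candidates, distTo]

theorem candidates_anti (h : S ⊆ T) : candidates G U R T ⊆ candidates G U R S := fun _ hv =>
  mem_candidates.2 ⟨hv.1, fun u hu => (mem_candidates.1 hv).2 u (h hu)⟩

theorem lt_natCast_iff_le_pred {d : ℕ∞} (hR : 1 ≤ R) :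
    d < R ↔ d ≤ ((R - 1 : ℕ) : ℕ∞) := by
  obtain ⟨r, rfl⟩ := Nat.exists_eq_add_of_le' hR
  simpa using ENat.lt_add_one_iff (ENat.natCast_ne_top r)

theorem isCovering_of_candidates_eq_empty (hR : 1 ≤ R) (h : candidates G U R S = ∅) :
    IsCovering G (R - 1) U S := by
  intro u hu
  have hnot := Set.eq_empty_iff_forall_notMem.1 h u
  simp only [mem_candidates, not_and, not_forall, not_le, hu, true_implies] at hnot
  obtain ⟨v, hv, hlt⟩ := hnot
  exact ⟨v, hv, (lt_natCast_iff_le_pred hR).1 hlt⟩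

theorem subset_greedyStep (S : Set V) : S ⊆ greedyStep G ℓ U R S := Set.subset_union_left

theorem subset_greedyStep_iterate (S : Set V) (k : ℕ) : S ⊆ (greedyStep G ℓ U R)^[k] S :=
  Function.id_le_iterate_of_id_le subset_greedyStep k S

theorem greedyStep_iterate_subset (hS : S ⊆ U) (k : ℕ) : (greedyStep G ℓ U R)^[k] S ⊆ U := by
  induction k with
  | zero => exact hS
  | succ k ih =>
    rw [Function.iterate_succ_apply']
    exact Set.union_subset ih fun _ hv => hv.1.1

theorem greedyStep_isPacking (hR : 1 ≤ R) (hS : IsPacking G R S) :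
    IsPacking G R (greedyStep G ℓ U R S) := by
  rintro u (hu | hu) v (hv | hv) huv
  · exact hS hu hv huv
  · simpa only [SimpleGraph.edist_comm] using (mem_candidates.1 hv.1).2 u hu
  · exact (mem_candidates.1 hu.1).2 v hv
  · by_contra hlt
    have hle : G.edist u v ≤ ((R - 1 : ℕ) : ℕ∞) :=
      (lt_natCast_iff_le_pred hR).1 (not_le.1 hlt)
    have hvu := hu.2 v hv.1 huv.symm hle
    have huv' := hv.2 u hu.1 huv (SimpleGraph.edist_comm ▸ hle)
    rcases hvu with h | ⟨h, hℓ⟩ <;> rcases huv' with h' | ⟨h', hℓ'⟩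
    · exact lt_asymm h h'
    · exact h.ne h'.symm
    · exact h'.ne h.symm
    · exact lt_asymm hℓ hℓ'

theorem greedyStep_iterate_isPacking (hR : 1 ≤ R) (hS : IsPacking G R S) (k : ℕ) :
    IsPacking G R ((greedyStep G ℓ U R)^[k] S) := by
  induction k with
  | zero => exact hS
  | succ k ih =>
    rw [Function.iterate_succ_apply']
    exact greedyStep_isPacking hR ih

/-- The candidates in the gap of `S` around `v`: no node of `S` separates them from `v` in the
order given by the positions `pos`. -/
def gapCandidates (G : SimpleGraph V) (U : Set V) (R : ℕ) (S : Set V) (pos : V → ℤ) (v : V) :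
    Set V :=
  {c | c ∈ candidates G U R S ∧ ∀ s ∈ S, (pos s < pos v ↔ pos s < pos c)}

theorem gapCandidates_anti (h : S ⊆ T) :
    gapCandidates G U R T pos v ⊆ gapCandidates G U R S pos v :=
  fun _ hc => ⟨candidates_anti h hc.1, fun s hs => hc.2 s (h hs)⟩

theorem edist_lt_of_mem_gapCandidates (hpos : IsIntEmbedding G pos) (hR : 1 ≤ R) {x y s t : V}
    (hx : x ∈ gapCandidates G U R S pos v) (hy : y ∈ gapCandidates G U R S pos v)
    (hs : s ∈ S) (ht : t ∈ S) (hxs : G.edist x s ≤ (4 * R - 1 : ℕ))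
    (hyt : G.edist y t ≤ (4 * R - 1 : ℕ)) (hst : pos s < pos v ↔ pos t < pos v) :
    G.edist x y < (3 * R : ℕ) := by
  have hfar : ∀ {c u}, c ∈ gapCandidates G U R S pos v → u ∈ S → R ≤ (pos c - pos u).natAbs :=
    fun hc hu => hpos.le_edist_iff.1 ((mem_candidates.1 hc.1).2 _ hu)
  have := hfar hx hs; have := hfar hx ht; have := hfar hy hs; have := hfar hy ht
  have := hx.2 s hs; have := hx.2 t ht; have := hy.2 s hs; have := hy.2 t ht
  rw [hpos.edist_le_iff] at hxs hyt
  rw [hpos.edist_lt_iff]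
  omega

theorem encard_le_of_subset_gapCandidates (hpos : IsIntEmbedding G pos) (hR : 1 ≤ R)
    (hS : IsCovering G (4 * R - 1) U S) {p : ℕ} (hp : k * p = 3 * R) (hX : IsPacking G p X)
    (hgap : X ⊆ gapCandidates G U R S pos v) : X.encard ≤ 2 * k := by
  refine hpos.encard_le_two_mul
    (fun x => ∃ s ∈ S, G.edist x s ≤ (4 * R - 1 : ℕ) ∧ pos s < pos v) hX fun x hx y hy hxy => ?_
  rw [hp]
  by_cases hleft : ∃ s ∈ S, G.edist x s ≤ (4 * R - 1 : ℕ) ∧ pos s < pos v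
  · obtain ⟨t, ht, hyt, htv⟩ := hxy.1 hleft
    obtain ⟨s, hs, hxs, hsv⟩ := hleft
    exact edist_lt_of_mem_gapCandidates hpos hR (hgap hx) (hgap hy) hs ht hxs hyt
      (iff_of_true hsv htv)
  · obtain ⟨s, hs, hxs⟩ := hS x (hgap hx).1.1
    obtain ⟨t, ht, hyt⟩ := hS y (hgap hy).1.1
    exact edist_lt_of_mem_gapCandidates hpos hR (hgap hx) (hgap hy) hs ht hxs hyt
      (iff_of_false (fun h => hleft ⟨s, hs, hxs, h⟩) fun h => hleft (hxy.2 ⟨t, ht, hyt, h⟩))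

theorem finite_gapCandidates (hpos : IsIntEmbedding G pos) (hR : 1 ≤ R)
    (hS : IsCovering G (4 * R - 1) U S) : (gapCandidates G U R S pos v).Finite :=
  Set.finite_of_encard_le_coe (k := 2 * (3 * R)) <| by
    simpa using encard_le_of_subset_gapCandidates hpos hR hS (mul_one _) (isPacking_one G _)
      subset_rfl

theorem exists_mem_gapCandidates_mem_greedyStep (hpos : IsIntEmbedding G pos)
    (hℓ : Function.Injective ℓ) (hR : 1 ≤ R) (hS : IsCovering G (4 * R - 1) U S)
    (hv : v ∈ candidates G U R S) :
    ∃ c ∈ gapCandidates G U R S pos v, c ∈ greedyStep G ℓ U R S := by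
  obtain ⟨c, hc, hmax⟩ := Set.exists_max_image (gapCandidates G U R S pos v)
    (fun u => toLex (distTo G S u, ℓ u)) (finite_gapCandidates hpos hR hS)
    ⟨v, hv, fun _ _ => Iff.rfl⟩
  refine ⟨c, hc, Or.inr ⟨hc.1, fun u hu huc hcu => ?_⟩⟩
  have hgap : u ∈ gapCandidates G U R S pos v := by
    refine ⟨hu, fun s hs => ?_⟩
    have hus := hpos.le_edist_iff.1 ((mem_candidates.1 hu).2 s hs)
    have hcu := hpos.edist_le_iff.1 hcu
    rw [hc.2 s hs]
    omega
  exact (Prod.Lex.toLex_le_toLex.1 (hmax u hgap)).imp id fun h =>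
    ⟨h.1, h.2.lt_of_ne fun he => huc (hℓ he)⟩

theorem exists_packing_subset_gapCandidates (hpos : IsIntEmbedding G pos)
    (hℓ : Function.Injective ℓ) (hR : 1 ≤ R) (hS : IsCovering G (4 * R - 1) U S)
    (hv : v ∈ candidates G U R ((greedyStep G ℓ U R)^[k] S)) :
    ∃ X ⊆ gapCandidates G U R S pos v, X.encard = (k + 1 : ℕ) ∧ IsPacking G R X := by
  induction k generalizing S with
  | zero =>
    exact ⟨{v}, Set.singleton_subset_iff.2 ⟨hv, fun _ _ => Iff.rfl⟩, by simp,
      Set.pairwise_singleton _ _⟩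
  | succ k ih =>
    obtain ⟨X, hXgap, hcard, hX⟩ := ih (hS.mono le_rfl (subset_greedyStep S)) hv
    obtain ⟨c, hcgap, hc⟩ := exists_mem_gapCandidates_mem_greedyStep (ℓ := ℓ) hpos hℓ hR hS
      (candidates_anti (subset_greedyStep_iterate S (k + 1)) hv)
    have hfar : ∀ x ∈ X, (R : ℕ∞) ≤ G.edist x c := fun x hx =>
      (mem_candidates.1 (hXgap hx).1).2 c hc
    have hcX : c ∉ X := fun h => by
      have := hfar c h
      rw [SimpleGraph.edist_self, ← Nat.cast_zero, Nat.cast_le] at this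
      omega
    refine ⟨insert c X, Set.insert_subset hcgap
      (hXgap.trans (gapCandidates_anti (subset_greedyStep S))), ?_, ?_⟩
    · rw [Set.encard_insert_of_notMem hcX, hcard]
      rfl
    · exact hX.insert fun x hx _ => ⟨SimpleGraph.edist_comm ▸ hfar x hx, hfar x hx⟩

/-- The number of iterations comes from the fact that an `R`-packing inside a gap has at most six
elements: three near each end. -/
theorem candidates_greedyStep_iterate_six (hpos : IsIntEmbedding G pos)
    (hℓ : Function.Injective ℓ) (hR : 1 ≤ R) (hS : IsCovering G (4 * R - 1) U S) :
    candidates G U R ((greedyStep G ℓ U R)^[6] S) = ∅ := by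
  rw [Set.eq_empty_iff_forall_notMem]
  intro v hv
  obtain ⟨X, hXgap, hcard, hX⟩ := exists_packing_subset_gapCandidates hpos hℓ hR hS hv
  have hle := encard_le_of_subset_gapCandidates (k := 3) hpos hR hS rfl hX hXgap
  rw [hcard] at hle
  exact absurd hle (by decide)

end Greedy

theorem IsOutput.isLimitedRulingSet (hG : IsPathOrLine G) (hℓ : Function.Injective ℓ)
    (hR : 1 ≤ R) {T : Set V} (hT : IsOutput G ℓ U R T) : IsLimitedRulingSet G U R (R - 1) T := by
  obtain ⟨pos, hpos⟩ := hG.exists_isIntEmbedding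
  obtain ⟨S, hS, rfl⟩ := isOutput_iff.1 hT
  refine ⟨greedyStep_iterate_subset hS.subset 6, fun u hu v hv => ?_, ?_⟩
  · exact greedyStep_iterate_isPacking hR hS.isPacking_depth 6 hu hv
  · exact isCovering_of_candidates_eq_empty hR
      (candidates_greedyStep_iterate_six hpos hℓ hR (hS.isCovering_depth hR))

end PathRulingSet

/-! ### Colour reduction -/

section Bits

variable {a b X : ℕ} {M N : Set ℕ}

/-- The lowest bit in which `a` and `b` differ; it is `0` when `a = b`. -/
noncomputable def firstDiff (a b : ℕ) : ℕ := sInf {i | a.testBit i ≠ b.testBit i}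

theorem testBit_firstDiff_ne (h : a ≠ b) :
    a.testBit (firstDiff a b) ≠ b.testBit (firstDiff a b) :=
  Nat.sInf_mem (s := {i | a.testBit i ≠ b.testBit i}) (Nat.exists_testBit_ne_of_ne h)

theorem firstDiff_le_log (h : a ≠ b) (ha : a ≤ X) (hb : b ≤ X) :
    firstDiff a b ≤ Nat.log 2 X := by
  refine Nat.le_log_of_pow_le (by norm_num) ?_
  rcases Bool.eq_false_or_eq_true (a.testBit (firstDiff a b)) with htrue | hfalse
  · exact (Nat.ge_two_pow_of_testBit htrue).trans ha
  · have hne := testBit_firstDiff_ne h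
    rw [hfalse] at hne
    exact (Nat.ge_two_pow_of_testBit (Bool.eq_true_of_not_eq_false hne.symm)).trans hb

/-- For each colour `b ∈ N`, the position of the lowest bit in which `a` differs from `b`,
together with the value of that bit in `a`. -/
noncomputable def diffBits (a : ℕ) (N : Set ℕ) : Set ℕ :=
  (fun b => Nat.bit (a.testBit (firstDiff a b)) (firstDiff a b)) '' N

theorem diffBits_ne (hab : a ≠ b) (hb : b ∈ N) : diffBits a N ≠ diffBits b M := by
  intro h
  obtain ⟨d, -, hd⟩ : Nat.bit (a.testBit (firstDiff a b)) (firstDiff a b) ∈ diffBits b M :=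
    h ▸ ⟨b, hb, rfl⟩
  have hpos : firstDiff b d = firstDiff a b := by simpa using congrArg Nat.div2 hd
  have hval : b.testBit (firstDiff b d) = a.testBit (firstDiff a b) := by
    simpa using congrArg Nat.bodd hd
  rw [hpos] at hval
  exact testBit_firstDiff_ne hab hval.symm

theorem diffBits_le (ha : a ≤ X) (hN : ∀ b ∈ N, a ≠ b ∧ b ≤ X) :
    ∀ p ∈ diffBits a N, p ≤ 2 * Nat.log 2 X + 1 := by
  rintro _ ⟨b, hb, rfl⟩
  have hlog := firstDiff_le_log (hN b hb).1 ha (hN b hb).2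
  have hbit := Bool.toNat_le (a.testBit (firstDiff a b))
  simp only [Nat.bit_val]
  omega

/-- The new colour of a node of colour `a` whose neighbours have the colours in `N`. It encodes
the set `diffBits a N` when that set has one or two elements. -/
noncomputable def reduceColour (a : ℕ) (N : Set ℕ) : ℕ :=
  Nat.pair (sInf (diffBits a N)) (sSup (diffBits a N))

theorem eq_pair_sInf_sSup {α : Type*} [ConditionallyCompleteLinearOrder α] {P : Set α}
    (hne : P.Nonempty) (hP : P.encard ≤ 2) : P = {sInf P, sSup P} := by
  rcases hP.eq_or_lt with htwo | hlt
  · obtain ⟨x, y, -, rfl⟩ := Set.encard_eq_two.1 htwo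
    rw [csSup_pair, csInf_pair]
    rcases le_total x y with hxy | hxy
    · rw [inf_eq_left.2 hxy, sup_eq_right.2 hxy]
    · rw [inf_eq_right.2 hxy, sup_eq_left.2 hxy, Set.pair_comm]
  · have hone : P.encard ≤ 1 := Order.le_of_lt_add_one (by rwa [one_add_one_eq_two])
    obtain ⟨x, rfl⟩ := (Set.encard_le_one_iff_eq.1 hone).resolve_left hne.ne_empty
    simp

theorem reduceColour_ne (hab : a ≠ b) (hb : b ∈ N) (ha : a ∈ M) (hN : N.encard ≤ 2)
    (hM : M.encard ≤ 2) : reduceColour a N ≠ reduceColour b M := by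
  intro h
  obtain ⟨hinf, hsup⟩ := Nat.pair_eq_pair.1 h
  apply diffBits_ne (M := M) hab hb
  rw [eq_pair_sInf_sSup (P := diffBits a N) (Set.Nonempty.image _ ⟨b, hb⟩)
      ((Set.encard_image_le _ _).trans hN),
    eq_pair_sInf_sSup (P := diffBits b M) (Set.Nonempty.image _ ⟨a, ha⟩)
      ((Set.encard_image_le _ _).trans hM), hinf, hsup]

theorem reduceColour_lt (ha : a ≤ X) (hN : ∀ b ∈ N, a ≠ b ∧ b ≤ X) :
    reduceColour a N < (2 * Nat.log 2 X + 2) ^ 2 := by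
  have hsup : sSup (diffBits a N) ≤ 2 * Nat.log 2 X + 1 := csSup_le' (diffBits_le ha hN)
  have hinf : sInf (diffBits a N) ≤ 2 * Nat.log 2 X + 1 := by
    rcases (diffBits a N).eq_empty_or_nonempty with hempty | hne
    · simp [hempty]
    · exact diffBits_le ha hN _ (Nat.sInf_mem hne)
  refine (Nat.pair_lt_max_add_one_sq _ _).trans_le (Nat.pow_le_pow_left ?_ 2)
  exact Nat.succ_le_succ (max_le hinf hsup)

end Bits

/-- The factor `1024` makes the bound stable: `2 * log₂ (1024 * x ^ 2) + 2 = 22 + 4 * log₂ x` is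
at most `32 * max (log₂ x) 1`. -/
theorem two_mul_log_add_two_sq_le {x : ℝ} (hx : 1 < x) :
    (((2 * Nat.log 2 ⌊1024 * x ^ 2⌋₊ + 2) ^ 2 : ℕ) : ℝ) ≤ 1024 * max (Real.logb 2 x) 1 ^ 2 := by
  have hlog_two : Real.logb 2 1024 = 10 := by
    rw [show (1024 : ℝ) = 2 ^ (10 : ℕ) by norm_num, Real.logb_pow,
      Real.logb_self_eq_one (by norm_num)]
    norm_num
  have hlog : (Nat.log 2 ⌊1024 * x ^ 2⌋₊ : ℝ) ≤ 10 + 2 * Real.logb 2 x := by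
    calc (Nat.log 2 ⌊1024 * x ^ 2⌋₊ : ℝ) ≤ Real.logb 2 ⌊1024 * x ^ 2⌋₊ := by
          exact_mod_cast Real.natLog_le_logb _ 2
      _ ≤ Real.logb 2 (1024 * x ^ 2) :=
          Real.logb_le_logb_of_le (by norm_num)
            (Nat.cast_pos.2 (Nat.floor_pos.2 (by nlinarith))) (Nat.floor_le (by positivity))
      _ = 10 + 2 * Real.logb 2 x := by
          rw [Real.logb_mul (by norm_num) (by positivity), Real.logb_pow, hlog_two]
          norm_num
  have hle := le_max_left (Real.logb 2 x) 1
  have hone := le_max_right (Real.logb 2 x) 1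
  calc (((2 * Nat.log 2 ⌊1024 * x ^ 2⌋₊ + 2) ^ 2 : ℕ) : ℝ)
      = (2 * Nat.log 2 ⌊1024 * x ^ 2⌋₊ + 2) ^ 2 := by push_cast; rfl
    _ ≤ (32 * max (Real.logb 2 x) 1) ^ 2 := pow_le_pow_left₀ (by positivity) (by linarith) 2
    _ = 1024 * max (Real.logb 2 x) 1 ^ 2 := by ring

section ColourReduction

variable {V : Type*} {H : SimpleGraph V} {c : V → ℕ}

/-- Adjacent nodes have different colours: the unbundled form of `SimpleGraph.Coloring`. -/
def IsProperColouring {α : Type*} (H : SimpleGraph V) (c : V → α) : Prop :=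
  ∀ ⦃u v⦄, H.Adj u v → c u ≠ c v

/-- One round of colour reduction in the style of Cole and Vishkin, for graphs of maximum degree
two. -/
noncomputable def colourReduction (H : SimpleGraph V) (c : V → ℕ) (v : V) : ℕ :=
  reduceColour (c v) (c '' H.neighborSet v)

theorem IsProperColouring.colourReduction (hc : IsProperColouring H c)
    (hH : ∀ v, (H.neighborSet v).encard ≤ 2) : IsProperColouring H (colourReduction H c) :=
  fun u v huv => reduceColour_ne (hc huv) ⟨v, huv, rfl⟩ ⟨u, huv.symm, rfl⟩
    ((Set.encard_image_le _ _).trans (hH u)) ((Set.encard_image_le _ _).trans (hH v))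

theorem IsProperColouring.colourReduction_iterate (hc : IsProperColouring H c)
    (hH : ∀ v, (H.neighborSet v).encard ≤ 2) (j : ℕ) :
    IsProperColouring H ((_root_.colourReduction H)^[j] c) := by
  induction j with
  | zero => exact hc
  | succ j ih =>
    rw [Function.iterate_succ_apply']
    exact ih.colourReduction hH

theorem IsProperColouring.colourReduction_le (hc : IsProperColouring H c) {x : ℝ} (hx : 1 < x)
    (h : ∀ v, (c v : ℝ) ≤ 1024 * max x 1 ^ 2) (v : V) :
    (_root_.colourReduction H c v : ℝ) ≤ 1024 * max (Real.logb 2 x) 1 ^ 2 := by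
  rw [max_eq_left hx.le] at h
  have hfloor : ∀ w, c w ≤ ⌊1024 * x ^ 2⌋₊ := fun w => Nat.le_floor (h w)
  have hlt : _root_.colourReduction H c v < (2 * Nat.log 2 ⌊1024 * x ^ 2⌋₊ + 2) ^ 2 := by
    refine reduceColour_lt (hfloor v) ?_
    rintro _ ⟨u, hu, rfl⟩
    exact ⟨hc hu, hfloor u⟩
  exact (Nat.cast_le.2 hlt.le).trans (two_mul_log_add_two_sq_le hx)

theorem IsProperColouring.colourReduction_iterate_le (hc : IsProperColouring H c)
    (hH : ∀ v, (H.neighborSet v).encard ≤ 2) {m : ℕ} {x : ℝ} (hm : logStar x = m + 1)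
    (h : ∀ v, (c v : ℝ) ≤ 1024 * max x 1 ^ 2) (v : V) :
    (_root_.colourReduction H)^[m] c v ≤ 1024 := by
  induction m generalizing c x with
  | zero =>
    have hx : x ≤ 1 := by
      by_contra hx
      rw [logStar_of_lt (not_le.1 hx), logStar] at hm
      omega
    have hv := h v
    rw [max_eq_right hx, one_pow, mul_one] at hv
    exact_mod_cast hv
  | succ m ih =>
    have hx : 1 < x := by
      by_contra hx
      rw [logStar_of_le (not_lt.1 hx)] at hm
      omega
    rw [logStar_of_lt hx] at hm
    exact ih (hc.colourReduction hH) (by omega) (hc.colourReduction_le hx h)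

end ColourReduction

/-! ### Maximal independent sets from colourings -/

section GreedyMIS

variable {V : Type*} {H : SimpleGraph V} {c : V → ℕ} {m n : ℕ}

/-- The independent set built greedily from the colour classes `0, …, m - 1`. -/
def greedyMIS (H : SimpleGraph V) (c : V → ℕ) : ℕ → Set V
  | 0 => ∅
  | m + 1 => greedyMIS H c m ∪ {v | c v = m ∧ ∀ u, H.Adj v u → u ∉ greedyMIS H c m}

theorem greedyMIS_mono : Monotone (greedyMIS H c) :=
  monotone_nat_of_le_succ fun _ => Set.subset_union_left

theorem not_adj_of_mem_greedyMIS (hc : IsProperColouring H c) {u v : V}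
    (hu : u ∈ greedyMIS H c m) (hv : v ∈ greedyMIS H c m) : ¬ H.Adj u v := by
  induction m with
  | zero => exact absurd hu (Set.notMem_empty u)
  | succ m ih =>
    intro h
    rcases hu with hu | hu <;> rcases hv with hv | hv
    · exact ih hu hv h
    · exact hv.2 u h.symm hu
    · exact hu.2 v h hv
    · exact hc h (hu.1.trans hv.1.symm)

theorem isMIS_greedyMIS (hc : IsProperColouring H c) (hm : ∀ v, c v < m) :
    IsMIS H (greedyMIS H c m) where
  independent _ hu _ hv := not_adj_of_mem_greedyMIS hc hu hv
  dominating u hu := by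
    by_contra! hfree
    exact hu (greedyMIS_mono (hm u)
      (Or.inr ⟨rfl, fun w huw hw => hfree w (greedyMIS_mono (hm u).le hw) huw⟩))

/-- The maximal independent set of a graph of maximum degree two obtained from colours at most `n`
by `log* n - 1` rounds of colour reduction, which leave the colours `0, …, 1024`, followed by the
greedy choice from the colour classes. -/
noncomputable def logStarMIS (n : ℕ) (H : SimpleGraph V) (c : V → ℕ) : Set V :=
  greedyMIS H ((colourReduction H)^[logStar n - 1] c) 1025

theorem isMIS_logStarMIS (hH : ∀ v, (H.neighborSet v).encard ≤ 2) (hc : IsProperColouring H c)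
    (hn : ∀ v, c v ≤ n) : IsMIS H (logStarMIS n H c) := by
  refine isMIS_greedyMIS (hc.colourReduction_iterate hH _) fun v =>
    Nat.lt_succ_of_le (hc.colourReduction_iterate_le hH (x := n) ?_ (fun w => ?_) v)
  · simp [logStar, add_comm]
  · have hw : (c w : ℝ) ≤ max (n : ℝ) 1 := (Nat.cast_le.2 (hn w)).trans (le_max_left _ _)
    have hone := le_max_right (n : ℝ) 1
    nlinarith

end GreedyMIS

section PowerGraph

variable {V : Type*} {G : SimpleGraph V} {S : Set V} {r : ℕ}

/-- The induced subgraph `G ^ r [S]`, as a graph on all nodes of `G` in which the nodes outside `S`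
are isolated. -/
def powerGraphOn (G : SimpleGraph V) (r : ℕ) (S : Set V) : SimpleGraph V :=
  ((powerGraph G r).induce S).spanningCoe

theorem powerGraphOn_adj {u v : V} :
    (powerGraphOn G r S).Adj u v ↔ u ∈ S ∧ v ∈ S ∧ u ≠ v ∧ G.edist u v ≤ r := by
  simp only [powerGraphOn, powerGraph, SimpleGraph.map_adj, SimpleGraph.comap_adj,
    Function.Embedding.subtype_apply, Subtype.exists, Order.one_le_iff_pos, pos_iff_ne_zero, ne_eq,
    SimpleGraph.edist_eq_zero_iff]
  constructor
  · rintro ⟨u, hu, v, hv, h, rfl, rfl⟩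
    exact ⟨hu, hv, h⟩
  · rintro ⟨hu, hv, h⟩
    exact ⟨u, hu, v, hv, h, rfl, rfl⟩

theorem encard_neighborSet_powerGraphOn_le {pos : V → ℤ} (hpos : IsIntEmbedding G pos) {p : ℕ}
    (hS : IsPacking G p S) (hr : r < 2 * p) (v : V) :
    ((powerGraphOn G r S).neighborSet v).encard ≤ 2 := by
  have hsub : (powerGraphOn G r S).neighborSet v ⊆ S := fun _ hu => (powerGraphOn_adj.1 hu).2.1
  have hle := hpos.encard_le_two_mul (k := 1) (fun u => pos v < pos u)
    (Set.Pairwise.mono hsub hS) fun x hx y hy hxy => ?_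
  · simpa using hle
  obtain ⟨hv, hxS, hvx, hdx⟩ := powerGraphOn_adj.1 hx
  obtain ⟨-, hyS, hvy, hdy⟩ := powerGraphOn_adj.1 hy
  have hfarx := hpos.le_edist_iff.1 (hS hv hxS hvx)
  have hfary := hpos.le_edist_iff.1 (hS hv hyS hvy)
  rw [hpos.edist_le_iff] at hdx hdy
  rw [hpos.edist_lt_iff]
  omega

theorem IsMIS.preimage_coe {K : SimpleGraph S} {M : Set V} (hM : IsMIS K.spanningCoe M) :
    IsMIS K (((↑) : S → V) ⁻¹' M) where
  independent u hu v hv huv := hM.independent u hu v hv (by simpa using huv)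
  dominating u hu := by
    obtain ⟨v, hv, huv⟩ := hM.dominating u hu
    obtain ⟨u', v', huv', hu', rfl⟩ := SimpleGraph.map_adj _ _ _ _ |>.1 huv
    obtain rfl : u' = u := Subtype.ext hu'
    exact ⟨v', hv, huv'⟩

end PowerGraph

/-! ### Full-information algorithms -/

namespace LocalAlgorithm

variable {In Out : Type}

/-- What a node can know after `t` rounds: its knowledge after `t - 1` rounds and the multiset of
what its neighbours knew by then. -/
def View (In : Type) : ℕ → Type
  | 0 => In
  | t + 1 => View In t × Multiset (View In t)

/-- What the node `v` learns in `t` rounds in which all nodes send all that they know. -/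
def view {V : Type*} (G : SimpleGraph V) [G.LocallyFinite] (input : V → In) :
    (t : ℕ) → V → View In t
  | 0, v => input v
  | t + 1, v => (view G input t v, (G.neighborFinset v).val.map (view G input t))

/-- The algorithm that collects information for `T` rounds and then applies `g`. The type of a view
depends on the round, so states carry the round number, and messages with a round number other
than the own one (which never occur) are discarded. -/
def fullInformation (T : ℕ) (g : View In T → Out) : LocalAlgorithm In Out where
  State := Σ t, View In t
  Msg := Σ t, View In t
  init x := ⟨0, x⟩
  send s := s
  receive s M := ⟨s.1 + 1, (s.2, M.filterMap fun m =>
    if h : m.1 = s.1 then some (h ▸ m.2) else none)⟩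
  output s := if h : s.1 = T then some (g (h ▸ s.2)) else none

section FullInformation

variable {T : ℕ} (g : View In T → Out) {V : Type*} (G : SimpleGraph V) [G.LocallyFinite]
  (input : V → In)

theorem run_fullInformation {t : ℕ} (ht : t ≤ T) (v : V) :
    (fullInformation T g).run G input t v = ⟨t, view G input t v⟩ := by
  induction t generalizing v with
  | zero => rfl
  | succ t ih =>
    have ih := ih (by omega)
    have hrunning : ∀ u, ((fullInformation T g).output ⟨t, view G input t u⟩).isSome = false := by
      intro u
      simp only [fullInformation, dif_neg (show t ≠ T by omega), Option.isSome_none]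
    rw [run]
    simp only [ih, hrunning, Bool.false_eq_true, if_false]
    simp only [fullInformation, view, Multiset.filterMap_filterMap, Option.bind_some, dite_true]
    rw [← Multiset.filterMap_eq_map]
    rfl

theorem output_run_fullInformation (v : V) :
    (fullInformation T g).output ((fullInformation T g).run G input T v) =
      some (g (view G input T v)) := by
  rw [run_fullInformation g G input le_rfl]
  simp [fullInformation]

end FullInformation

end LocalAlgorithm

universe u

/-- The inputs on which the LOCAL algorithm for identifiers at most `n` has to be correct. The graph
and the set `U` are bundled because the locality of a construction compares its results on
different inputs. -/
structure PathInput (n : ℕ) where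
  V : Type u
  G : SimpleGraph V
  [locallyFinite : G.LocallyFinite]
  ℓ : V → ℕ+
  U : Set V
  isPathOrLine : IsPathOrLine G
  injective : Function.Injective ℓ
  le : ∀ v ∈ U, (ℓ v : ℕ) ≤ n

attribute [instance] PathInput.locallyFinite

/-! ### Locality -/

namespace PathInput

open LocalAlgorithm PathRulingSet

variable {n : ℕ}

/-- The nodes `v` and `w`, of possibly different inputs, cannot be told apart in `t` rounds. -/
def SameView {I J : PathInput.{u} n} (t : ℕ) (v : I.V) (w : J.V) : Prop :=
  view I.G (localInput I.ℓ I.U) t v = view J.G (localInput J.ℓ J.U) t w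

namespace SameView

variable {I J : PathInput.{u} n} {v x : I.V} {w : J.V} {s t k : ℕ}

theorem symm (h : SameView t v w) : SameView t w v :=
  Eq.symm h

theorem mono (h : SameView t v w) (hst : s ≤ t) : SameView s v w := by
  induction t, hst using Nat.le_induction with
  | base => exact h
  | succ t _ ih => exact ih (congrArg Prod.fst h)

theorem ℓ_eq (h : SameView t v w) : I.ℓ v = J.ℓ w :=
  congrArg Prod.fst (h.mono (Nat.zero_le t))

theorem mem_U_iff (h : SameView t v w) : v ∈ I.U ↔ w ∈ J.U :=
  decide_eq_decide.1 (congrArg Prod.snd (h.mono (Nat.zero_le t)))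

theorem exists_adj (h : SameView (t + 1) v w) (hx : I.G.Adj v x) :
    ∃ y, J.G.Adj w y ∧ SameView t x y := by
  have hviews : (I.G.neighborFinset v).val.map (view I.G (localInput I.ℓ I.U) t) =
      (J.G.neighborFinset w).val.map (view J.G (localInput J.ℓ J.U) t) := congrArg Prod.snd h
  have hmem := Multiset.mem_map_of_mem (view I.G (localInput I.ℓ I.U) t)
    ((I.G.mem_neighborFinset v x).2 hx)
  rw [hviews, Multiset.mem_map] at hmem
  obtain ⟨y, hy, hxy⟩ := hmem
  exact ⟨y, (J.G.mem_neighborFinset w y).1 hy, hxy.symm⟩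

theorem exists_edist_le (h : SameView (t + k) v w) (hx : I.G.edist v x ≤ k) :
    ∃ y, J.G.edist w y ≤ k ∧ SameView t x y := by
  induction k generalizing v w with
  | zero =>
    obtain rfl : v = x := I.G.edist_eq_zero_iff.1 (nonpos_iff_eq_zero.1 hx)
    exact ⟨w, by simp, h⟩
  | succ k ih =>
    obtain ⟨p, hp⟩ := I.isPathOrLine.connected.exists_walk_length_eq_edist v x
    have hlen : p.length ≤ k + 1 := Nat.cast_le.1 (hp.trans_le hx)
    cases p with
    | nil => exact ⟨w, by simp, h.mono (by omega)⟩
    | @cons _ v' _ hadj q =>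
      rw [SimpleGraph.Walk.length_cons] at hlen
      obtain ⟨w', hw', hview⟩ := exists_adj (t := t + k) h hadj
      obtain ⟨y, hy, hxy⟩ := ih hview
        ((SimpleGraph.edist_le q).trans (Nat.cast_le.2 (by omega)))
      refine ⟨y, SimpleGraph.edist_triangle.trans
        ((add_le_add (SimpleGraph.edist_eq_one_iff_adj.2 hw').le hy).trans ?_), hxy⟩
      rw [Nat.cast_add, Nat.cast_one, add_comm]

end SameView

/-- A node can compute `f` in `t` rounds. -/
def IsLocal {Y : Type*} (t : ℕ) (f : ∀ I : PathInput.{u} n, I.V → Y) : Prop :=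
  ∀ ⦃I J : PathInput.{u} n⦄ ⦃v : I.V⦄ ⦃w : J.V⦄, SameView t v w → f I v = f J w

/-- A node can decide in `t` rounds whether it belongs to `S`. One implication suffices because
`SameView` is symmetric. -/
def IsLocalSet (t : ℕ) (S : ∀ I : PathInput.{u} n, Set I.V) : Prop :=
  ∀ ⦃I J : PathInput.{u} n⦄ ⦃v : I.V⦄ ⦃w : J.V⦄, SameView t v w → v ∈ S I → w ∈ S J

/-- One round on the graph `H` can be simulated in `r` rounds on the underlying path, provided that
the nodes know what they can learn in `t` rounds. -/
def IsLocalGraph (t r : ℕ) (H : ∀ I : PathInput.{u} n, SimpleGraph I.V) : Prop :=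
  ∀ ⦃s : ℕ⦄, t ≤ s → ∀ ⦃I J : PathInput.{u} n⦄ ⦃v x : I.V⦄ ⦃w : J.V⦄,
    SameView (s + r) v w → (H I).Adj v x → ∃ y, (H J).Adj w y ∧ SameView s x y

section Locality

variable {s t r β R : ℕ} {S : ∀ I : PathInput.{u} n, Set I.V}
  {H : ∀ I : PathInput.{u} n, SimpleGraph I.V} {c : ∀ I : PathInput.{u} n, I.V → ℕ}

theorem IsLocalSet.mono (hS : IsLocalSet s S) (hst : s ≤ t) : IsLocalSet t S :=
  fun _ _ _ _ h => hS (h.mono hst)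

theorem IsLocalSet.powerGraphOn (hS : IsLocalSet t S) (r : ℕ) :
    IsLocalGraph t r fun I => powerGraphOn I.G r (S I) := by
  intro s hs I J v x w h hadj
  obtain ⟨hv, hx, hvx, hd⟩ := powerGraphOn_adj.1 hadj
  obtain ⟨y, hy, hxy⟩ := h.exists_edist_le hd
  refine ⟨y, powerGraphOn_adj.2 ⟨hS (h.mono (by omega)) hv, hS (hxy.mono hs) hx, ?_, hy⟩, hxy⟩
  rintro rfl
  exact hvx (I.injective (h.ℓ_eq.trans hxy.ℓ_eq.symm))

theorem IsLocal.colourReduction (hH : IsLocalGraph t r H) (hts : t ≤ s) (hc : IsLocal s c) :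
    IsLocal (s + r) fun I => colourReduction (H I) (c I) := by
  have himage : ∀ ⦃I J : PathInput.{u} n⦄ ⦃v : I.V⦄ ⦃w : J.V⦄, SameView (s + r) v w →
      c I '' (H I).neighborSet v ⊆ c J '' (H J).neighborSet w := by
    rintro I J v w h _ ⟨x, hx, rfl⟩
    obtain ⟨y, hy, hxy⟩ := hH hts h hx
    exact ⟨y, hy, (hc hxy).symm⟩
  intro I J v w h
  exact congrArg₂ reduceColour (hc (h.mono (Nat.le_add_right s r)))
    ((himage h).antisymm (himage h.symm))

theorem IsLocal.colourReduction_iterate (hH : IsLocalGraph t r H) (hc : IsLocal t c) (j : ℕ) :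
    IsLocal (t + j * r) fun I => (_root_.colourReduction (H I))^[j] (c I) := by
  induction j with
  | zero => simpa using hc
  | succ j ih =>
    simp only [Function.iterate_succ_apply']
    rw [Nat.succ_mul, ← add_assoc]
    exact ih.colourReduction hH (Nat.le_add_right t _)

theorem IsLocal.greedyMIS (hH : IsLocalGraph t r H) (hts : t ≤ s) (hc : IsLocal s c) (m : ℕ) :
    IsLocalSet (s + m * r) fun I => greedyMIS (H I) (c I) m := by
  induction m with
  | zero => exact fun _ _ _ _ _ hv => hv
  | succ m ih =>
    rw [Nat.succ_mul, ← add_assoc]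
    rintro I J v w h (hv | ⟨hv, hfree⟩)
    · exact Or.inl (ih (h.mono (Nat.le_add_right _ r)) hv)
    · refine Or.inr ⟨(hc (h.mono (by omega))).symm.trans hv, fun y hy hmem => ?_⟩
      obtain ⟨x, hx, hyx⟩ := hH (by omega) h.symm hy
      exact hfree x hx (ih hyx hmem)

theorem IsLocal.logStarMIS (hH : IsLocalGraph t r H) (hc : IsLocal t c) :
    IsLocalSet (t + (logStar n + 1024) * r) fun I => logStarMIS n (H I) (c I) := by
  have hrounds : logStar n + 1024 = logStar n - 1 + 1025 := by
    unfold logStar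
    omega
  rw [hrounds, add_mul, ← add_assoc]
  exact (hc.colourReduction_iterate hH _).greedyMIS hH (Nat.le_add_right t _) 1025

theorem IsLocalSet.distTo_le (hS : IsLocalSet t S) (hcov : ∀ I, IsCovering I.G β I.U (S I))
    {I J : PathInput.{u} n} {v : I.V} {w : J.V} (hw : w ∈ J.U) (h : SameView (t + β) v w) :
    distTo J.G (S J) w ≤ distTo I.G (S I) v := by
  refine le_iInf₂ fun x hx => ?_
  rcases le_or_gt (I.G.edist v x) β with hnear | hfar
  · obtain ⟨k, hk⟩ := ENat.ne_top_iff_exists.1 (ne_top_of_le_ne_top (ENat.natCast_ne_top β) hnear)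
    rw [← hk] at hnear ⊢
    obtain ⟨y, hy, hxy⟩ :=
      (h.mono (Nat.add_le_add_left (Nat.cast_le.1 hnear) t)).exists_edist_le hk.ge
    exact (iInf₂_le y (hS hxy hx)).trans hy
  · obtain ⟨y, hy, hd⟩ := hcov J w hw
    exact (iInf₂_le y hy).trans (hd.trans hfar.le)

theorem IsLocalSet.distTo_eq (hS : IsLocalSet t S) (hcov : ∀ I, IsCovering I.G β I.U (S I))
    {I J : PathInput.{u} n} {v : I.V} {w : J.V} (hv : v ∈ I.U) (h : SameView (t + β) v w) :
    distTo I.G (S I) v = distTo J.G (S J) w :=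
  (hS.distTo_le hcov hv h.symm).antisymm (hS.distTo_le hcov (h.mem_U_iff.1 hv) h)

theorem IsLocalSet.candidates (hS : IsLocalSet t S)
    (hcov : ∀ I, IsCovering I.G β I.U (S I)) :
    IsLocalSet (t + β) fun I => candidates I.G I.U R (S I) :=
  fun _ _ _ _ h hv => ⟨h.mem_U_iff.1 hv.1, hS.distTo_eq hcov hv.1 h ▸ hv.2⟩

theorem IsLocalSet.greedyStep (hS : IsLocalSet t S)
    (hcov : ∀ I, IsCovering I.G β I.U (S I)) :
    IsLocalSet (t + (β + R)) fun I => greedyStep I.G I.ℓ I.U R (S I) := by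
  have hcand := hS.candidates (R := R) hcov
  rintro I J v w h (hv | ⟨hv, hmax⟩)
  · exact Or.inl (hS (h.mono (Nat.le_add_right t _)) hv)
  have hnear : SameView (t + β) v w := h.mono (by omega)
  refine Or.inr ⟨hcand hnear hv, fun y hy hyw hd => ?_⟩
  obtain ⟨x, hx, hyx⟩ := SameView.exists_edist_le (t := t + β) (h.symm.mono (by omega)) hd
  have hxv : x ≠ v := by
    rintro rfl
    exact hyw (J.injective (hyx.ℓ_eq.trans h.ℓ_eq))
  rw [hS.distTo_eq hcov hy.1 hyx, ← hS.distTo_eq hcov hv.1 hnear, hyx.ℓ_eq, ← h.ℓ_eq]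
  exact hmax x (hcand hyx hy) hxv hx

theorem IsLocalSet.greedyStep_iterate (hS : IsLocalSet t S)
    (hcov : ∀ I, IsCovering I.G β I.U (S I)) (k : ℕ) :
    IsLocalSet (t + k * (β + R)) fun I =>
      (PathRulingSet.greedyStep I.G I.ℓ I.U R)^[k] (S I) := by
  induction k with
  | zero => simpa using hS
  | succ k ih =>
    simp only [Function.iterate_succ_apply']
    rw [Nat.succ_mul, ← add_assoc]
    exact ih.greedyStep fun I => (hcov I).mono le_rfl (subset_greedyStep_iterate _ k)

end Locality

/-! ### The distributed execution of PathRulingSet -/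

section Execution

variable (I : PathInput.{u} n) (R : ℕ)

/-- The initial colours of the colour reduction: the identifiers, but `0` outside `U`, where the
identifiers are not bounded by `n`. -/
noncomputable def initialColour : I.V → ℕ :=
  I.U.indicator fun v => (I.ℓ v : ℕ)

theorem initialColour_le (v : I.V) : I.initialColour v ≤ n :=
  Set.indicator_apply_le' (I.le v) fun _ => Nat.zero_le n

theorem isProperColouring_initialColour {S : Set I.V} (hS : S ⊆ I.U) (r : ℕ) :
    IsProperColouring (powerGraphOn I.G r S) I.initialColour := by
  intro v w hvw
  obtain ⟨hv, hw, hne, -⟩ := powerGraphOn_adj.1 hvw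
  rw [initialColour, Set.indicator_of_mem (hS hv), Set.indicator_of_mem (hS hw)]
  exact fun h => hne (I.injective (PNat.eq h))

theorem isLocal_initialColour (t : ℕ) : IsLocal t (initialColour (n := n)) := by
  classical
  intro I J v w h
  simp only [initialColour, Set.indicator_apply, h.mem_U_iff, h.ℓ_eq]

/-- The sets `S₀ = U, S₁, …, S_d` of the first loop, with the maximal independent sets computed by
`logStarMIS`. -/
noncomputable def misChain : ℕ → Set I.V
  | 0 => I.U
  | i + 1 => misChain i ∩
      logStarMIS n (powerGraphOn I.G (radius R (i + 1)) (misChain i)) I.initialColour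

theorem isMISChain_misChain {k : ℕ} (hk : k ≤ depth R) :
    IsMISChain I.G I.U R (I.misChain R) k := by
  obtain ⟨pos, hpos⟩ := I.isPathOrLine.exists_isIntEmbedding
  induction k with
  | zero => exact ⟨rfl, fun i hi => absurd hi (Nat.not_lt_zero i)⟩
  | succ k ih =>
    have ih := ih (by omega)
    refine ⟨rfl, fun i hi => ?_⟩
    rcases Nat.lt_succ_iff_lt_or_eq.1 hi with hi | rfl
    · exact ih.2 i hi
    have hdegree := encard_neighborSet_powerGraphOn_le hpos ih.isPacking (radius_succ_lt hk)
    have hmis := isMIS_logStarMIS hdegree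
      (I.isProperColouring_initialColour ih.subset _) I.initialColour_le
    exact ⟨_, hmis.preimage_coe, Subtype.image_preimage_coe _ _ |>.symm⟩

theorem isLocalSet_misChain (n R : ℕ) {k : ℕ} (hk : k ≤ depth R) :
    IsLocalSet ((logStar n + 1024) * 2 ^ (k + 1)) fun I : PathInput.{u} n => I.misChain R k := by
  induction k with
  | zero => exact fun _ _ _ _ h => h.mem_U_iff.1
  | succ k ih =>
    have ih := ih (by omega)
    have hmis := (isLocal_initialColour _).logStarMIS (ih.powerGraphOn (radius R (k + 1)))
    have hrounds : (logStar n + 1024) * 2 ^ (k + 1) + (logStar n + 1024) * radius R (k + 1) ≤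
        (logStar n + 1024) * 2 ^ (k + 1 + 1) := by
      have hradius := (radius_lt_two_pow hk).le
      calc _ ≤ (logStar n + 1024) * 2 ^ (k + 1) + (logStar n + 1024) * 2 ^ (k + 1) := by gcongr
        _ = (logStar n + 1024) * 2 ^ (k + 1 + 1) := by ring
    intro I J v w h hv
    have h := h.mono hrounds
    exact ⟨ih (h.mono (Nat.le_add_right _ _)) hv.1, hmis h hv.2⟩

/-- The set computed by the distributed execution. -/
noncomputable def rulingSet : Set I.V :=
  (greedyStep I.G I.ℓ I.U R)^[6] (I.misChain R (depth R))

theorem isOutput_rulingSet : IsOutput I.G I.ℓ I.U R (I.rulingSet R) :=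
  isOutput_iff.2 ⟨_, I.isMISChain_misChain R le_rfl, rfl⟩

theorem isLocalSet_rulingSet (n : ℕ) {R : ℕ} (hR : 1 ≤ R) :
    IsLocalSet (4130 * R * logStar n) fun I : PathInput.{u} n => I.rulingSet R := by
  have hlocal := (isLocalSet_misChain n R le_rfl).greedyStep_iterate (R := R)
    (fun I => (I.isMISChain_misChain R le_rfl).isCovering_depth hR) 6
  refine hlocal.mono ?_
  have hlogStar : 1 ≤ logStar n := Nat.le_add_right _ _
  have hpow : 2 ^ (depth R + 1) ≤ 4 * R := by
    have := two_pow_depth_lt hR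
    omega
  calc (logStar n + 1024) * 2 ^ (depth R + 1) + 6 * (4 * R - 1 + R)
      ≤ (logStar n + 1024) * (4 * R) + 30 * R :=
        add_le_add (Nat.mul_le_mul_left _ hpow) (by omega)
    _ ≤ (logStar n + 1024 * logStar n) * (4 * R) + 30 * R * logStar n := by
        refine add_le_add (Nat.mul_le_mul_right _ (Nat.add_le_add_left ?_ _)) ?_ <;>
          exact Nat.le_mul_of_pos_right _ hlogStar
    _ = 4130 * R * logStar n := by ring

open Classical in
/-- The output of a node with view `a` in the distributed execution: whether some node of some
input has this view and belongs to `rulingSet`. -/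
noncomputable def decision (n R T : ℕ) (a : View (ℕ+ × Bool) T) : Bool :=
  decide (∃ (I : PathInput.{u} n) (v : I.V),
    view I.G (localInput I.ℓ I.U) T v = a ∧ v ∈ I.rulingSet R)

theorem computesWithin_decision {T : ℕ}
    (hT : IsLocalSet T fun I : PathInput.{u} n => I.rulingSet R) :
    (fullInformation T (decision.{u} n R T)).ComputesWithin I.G I.ℓ I.U (I.rulingSet R) T := by
  intro v
  rw [output_run_fullInformation, decision]
  refine congrArg some (decide_eq_decide.2 ⟨?_, fun hv => ⟨I, v, rfl, hv⟩⟩)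
  rintro ⟨J, w, hwv, hw⟩
  exact hT hwv hw

end Execution

end PathInput

theorem mainTheorem5_general :
    (∀ (V : Type*) (G : SimpleGraph V) (ℓ : V → ℕ+) (U : Set V) (R : ℕ),
      IsPathOrLine G → Function.Injective ℓ → 1 ≤ R →
      ∀ S : Set V, PathRulingSet.IsOutput G ℓ U R S → IsLimitedRulingSet G U R (R - 1) S) ∧
    ∃ (C : ℕ) (A : ℕ → ℕ → LocalAlgorithm (ℕ+ × Bool) Bool),
      ∀ (n R : ℕ), 1 ≤ R →
      ∀ (V : Type*) (G : SimpleGraph V) [G.LocallyFinite] (ℓ : V → ℕ+) (U : Set V),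
        IsPathOrLine G → Function.Injective ℓ → (∀ v ∈ U, (ℓ v : ℕ) ≤ n) →
        ∃ S : Set V, PathRulingSet.IsOutput G ℓ U R S ∧
          IsLimitedRulingSet G U R (R - 1) S ∧
          (A n R).ComputesWithin G ℓ U S (C * R * logStar n) := by
  refine ⟨fun V G ℓ U R hG hℓ hR S hS => hS.isLimitedRulingSet hG hℓ hR,
    4130, fun n R => .fullInformation _ (PathInput.decision n R (4130 * R * logStar n)), ?_⟩
  intro n R hR V G _ ℓ U hG hℓ hn
  let I : PathInput n := ⟨V, G, ℓ, U, hG, hℓ, hn⟩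
  have hout : PathRulingSet.IsOutput G ℓ U R (I.rulingSet R) := I.isOutput_rulingSet R
  exact ⟨I.rulingSet R, hout, hout.isLimitedRulingSet hG hℓ hR,
    I.computesWithin_decision R (PathInput.isLocalSet_rulingSet n hR)⟩

/-- PathRulingSet computes a `U`-limited `(R, R - 1)`-ruling set of a path or line `G`, whichever
maximal independent sets are chosen, and it can be executed in `O(R log* n)` rounds of
deterministic LOCAL when the nodes know `n` and `R` and the identifiers in `U` are at most `n`. -/
theorem mainTheorem5 :
    (∀ (V : Type*) (G : SimpleGraph V) (ℓ : V → ℕ+) (U : Set V) (R : ℕ),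
      IsPathOrLine G → Function.Injective ℓ → U.Finite → 1 ≤ R →
      ∀ S : Set V, PathRulingSet.IsOutput G ℓ U R S → IsLimitedRulingSet G U R (R - 1) S) ∧
    ∃ (C : ℕ) (A : ℕ → ℕ → LocalAlgorithm (ℕ+ × Bool) Bool),
      ∀ (n R : ℕ), 1 ≤ R →
      ∀ (V : Type*) (G : SimpleGraph V) [G.LocallyFinite] (ℓ : V → ℕ+) (U : Set V),
        IsPathOrLine G → Function.Injective ℓ → U.Finite → (∀ v ∈ U, (ℓ v : ℕ) ≤ n) →
        ∃ S : Set V, PathRulingSet.IsOutput G ℓ U R S ∧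
          IsLimitedRulingSet G U R (R - 1) S ∧
          (A n R).ComputesWithin G ℓ U S (C * R * logStar n) :=
  mainTheorem5_general.imp (fun h V G ℓ U R hG hℓ _ => h V G ℓ U R hG hℓ) fun ⟨C, A, hA⟩ =>
    ⟨C, A, fun n R hR V G _ ℓ U hG hℓ _ => hA n R hR V G ℓ U hG hℓ⟩
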